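/- **Soundness of weakest preexpectation semantics.** *States.* Let $\mathsf{Vars}$ be a set of variables. A stack is a map $s\colon \mathsf{Vars}\to\mathbb Z$; a heap is a finite partial map $h\colon \mathbb N_{>0}\rightharpoonup\mathbb Z$ with domain $\mathrm{dom}(h)$. Write $h_1\perp h_2$ if the domains are disjoint, $h_1\star h_2$ for the union of disjoint heaps, and $\{u\mapsto v_1,\dots,v_n\}$ for the heap with cells $u,\dots,u+n-1$ and contents $v_1,\dots,v_n$. A state is a pair $(s,h)$. Expressions $e$ (integer-valued) and guards $b$ (Boolean-valued) depend on the stack only, with values $s(e)$, $s(b)$. An expectation is a map $X$ from states to $[0,\infty]$; expectations are ordered pointwise, and $0\cdot\infty=0$. *Programs (hpgcl).* $$c ::= \mathtt{skip}\mid x:=e\mid c;c\mid \mathtt{if}(b)\{c\}\{c\}\mid\mathtt{while}(b)\{c\}\mid\{c\}[p]\{c\}\mid x:=\mathtt{new}(e_1,\dots,e_n)\mid \langle e\rangle:=e'\mid x:=\langle e\rangle\mid\mathtt{free}(e),$$ where $p\in[0,1]\cap\mathbb Q$ and $n\ge1$. *Operational model.* Configurations are pairs of a program, or $\Downarrow$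 (successful termination), or $\lightning$ (memory fault), with a state. A step $t\xrightarrow{a,p}t'$ has an action $a\in\mathbb N$ and a probability $p$. All steps other than those mentioned below have action $0$ and probability $1$: - $\mathtt{skip},s,h\to{\Downarrow},s,h$; and $x:=e,s,h\to{\Downarrow},s[x:=s(e)],h$. - $\mathtt{if}(b)\{c_1\}\{c_2\},s,h$ steps to $c_1,s,h$ if $s(b)$ is true and to $c_2,s,h$ otherwise. - $\mathtt{while}(b)\{c\},s,h$ steps to $c;\mathtt{while}(b)\{c\},s,h$ if $s(b)$ is true and to ${\Downarrow},s,h$ otherwise. - $\{c_1\}[p]\{c_2\},s,h$ has two steps with action $0$: to $c_1,s,h$ with probability $p$ and to $c_2,s,h$ with probability $1-p$. They are counted separately even if they coincide. - $x:=\mathtt{new}(e_1,\dots,e_n),s,h$ steps, for every $u\in\mathbb N_{>0}$ with $u,\dots,u+n-1\notin\mathrm{dom}(h)$, with action $u$ and probability $1$ to ${\Downarrow},s[x:=u],h\star\{u\mapsto s(e_1),\dots,s(e_n)\}$. - $\langle e\rangle:=e'$, $x:=\langle e\rangle$ and $\mathtt{free}(e)$ step from $s,h$ to $\lightning,s,h$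 if $s(e)\notin\mathrm{dom}(h)$. If $u=s(e)\in\mathrm{dom}(h)$, they step to $\Downarrow$ with state $(s,h[u:=s(e')])$, $(s[x:=h(u)],h)$, and $(s,h\text{ with cell }u\text{ removed})$, respectively. - If $c_1,s,h\xrightarrow{a,p}c_1',s',h'$, then $c_1;c_2,s,h\xrightarrow{a,p}c_1';c_2,s',h'$, with ${\Downarrow};c_2$ read as $c_2$ and $\lightning;c_2$ read as $\lightning$. Let $\mathrm{Prob}(t,a,t')$ be the sum of the probabilities of all steps from $t$ to $t'$ with action $a$. Action $a$ is available at $t$ if some step from $t$ with action $a$ has positive probability. A scheduler $\rho$ maps each nonempty finite sequence of configurations to a natural number, which must be an action available at the last configuration of the sequence whenever any action is available there. Let $\mathrm{Paths}_\rho(t)$ be the set of finite sequences $t_1\dots t_m$ ($m\geq 1$) with $t_1=t$, $t_m$ of the form $(\Downarrow,s',h')$, and $\mathrm{Prob}(t_k,\rho(t_1\dots t_k),t_{k+1})>0$ for all $1\le k<m$. Let $\mathrm{rew}_X(\Downarrow,s,h)=X(s,h)$ and $\mathrm{rew}_X=0$ on all other configurations. The minimal expected reward of successful termination is $$\mathrm{ExpRew}_X(t)=\inf_\rho\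 \sum_{t_1\dots t_m\in\mathrm{Paths}_\rho(t)}\Big(\prod_{1\le k<m}\mathrm{Prob}(t_k,\rho(t_1\dots t_k),t_{k+1})\Big)\cdot\mathrm{rew}_X(t_m).$$ *Weakest preexpectations.* Let $[\varphi]$ be the indicator of a predicate $\varphi$ on states, $X[x:=e](s,h)=X(s[x:=s(e)],h)$, and $$(X\star Y)(s,h)=\max_{h=h_1\star h_2}X(s,h_1)\,Y(s,h_2),\qquad(\varphi\mathbin{-\!\star}X)(s,h)=\inf\{X(s,h\star h')\mid h'\perp h,\ (s,h')\models\varphi\}.$$ Let $e\mapsto e_1,\dots,e_n$ hold at $(s,h)$ iff $s(e)\in\mathbb N_{>0}$ and $h=\{s(e)\mapsto s(e_1),\dots,s(e_n)\}$, and let $e\mapsto -$ hold iff $\mathrm{dom}(h)=\{s(e)\}$. Then $\mathsf{wp}[c]$ is defined by recursion on $c$: - $\mathsf{wp}[\mathtt{skip}](X)=X$; $\mathsf{wp}[x:=e](X)=X[x:=e]$; $\mathsf{wp}[c_1;c_2](X)=\mathsf{wp}[c_1](\mathsf{wp}[c_2](X))$; - $\mathsf{wp}[\mathtt{if}(b)\{c_1\}\{c_2\}](X)=[b]\cdot\mathsf{wp}[c_1](X)+[\neg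 b]\cdot\mathsf{wp}[c_2](X)$; - $\mathsf{wp}[\mathtt{while}(b)\{c\}](X)$ is the least fixed point of $Y\mapsto[\neg b]\cdot X+[b]\cdot\mathsf{wp}[c](Y)$; - $\mathsf{wp}[\{c_1\}[p]\{c_2\}](X)=p\cdot\mathsf{wp}[c_1](X)+(1-p)\cdot\mathsf{wp}[c_2](X)$; - $\mathsf{wp}[x:=\mathtt{new}(e_1,\dots,e_n)](X)(s,h)=\inf_v\big((v\mapsto e_1,\dots,e_n)\mathbin{-\!\star}X[x:=v]\big)(s,h)$, over all $v\in\mathbb N_{>0}$ with $v,\dots,v+n-1\notin\mathrm{dom}(h)$; - $\mathsf{wp}[\langle e\rangle:=e'](X)=[e\mapsto-]\star\big((e\mapsto e')\mathbin{-\!\star}X\big)$; - $\mathsf{wp}[x:=\langle e\rangle](X)=\sup_{v\in\mathbb Z}\,[e\mapsto v]\star\big((e\mapsto v)\mathbin{-\!\star}X[x:=v]\big)$; - $\mathsf{wp}[\mathtt{free}(e)](X)=[e\mapsto-]\star X$. **Theorem.** For every hpgcl program $c$, every expectation $X$ and every initial state $(s,h)$, $$\mathsf{wp}[c](X)(s,h)=\mathrm{ExpRew}_X(c,s,h).$$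 -/

import Mathlib

open scoped ENNReal

namespace HPGCL

/-! ### Program states -/

/-- Stacks: valuations of the variables by integers. -/
abbrev Stack (V : Type*) : Type _ := V → ℤ

/-- Heaps: finite partial maps from positive natural numbers (addresses) to integers. -/
@[ext]
structure Heap where
  cells : ℕ+ → Option ℤ
  finite_alloc : {a | cells a ≠ none}.Finite

namespace Heap

/-- The set of allocated addresses. -/
def dom (h : Heap) : Set ℕ+ := {a | h.cells a ≠ none}

/-- Disjointness of heaps. -/
def Disj (h₁ h₂ : Heap) : Prop := Disjoint h₁.dom h₂.dom

/-- The union `h₁ ⋆ h₂` of two heaps; it is only used for disjoint heaps. -/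
def union (h₁ h₂ : Heap) : Heap where
  cells a := (h₁.cells a).or (h₂.cells a)
  finite_alloc := by
    refine (h₁.finite_alloc.union h₂.finite_alloc).subset ?_
    intro a ha
    by_contra hc
    simp only [Set.mem_union, Set.mem_ofPred_eq, not_or, not_not] at hc
    exact ha (by simp [hc.1, hc.2])

/-- The heap `{u ↦ v₁, …, vₙ}` with the cells `u, u + 1, …, u + n - 1`. -/
def block (u : ℕ+) (vs : List ℤ) : Heap where
  cells a := if (u : ℕ) ≤ (a : ℕ) then vs[(a : ℕ) - (u : ℕ)]? else none
  finite_alloc := by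
    refine Set.Finite.subset
      ((Set.finite_lt_nat ((u : ℕ) + vs.length)).preimage
        (f := fun a : ℕ+ => (a : ℕ)) (fun a _ b _ hab => PNat.coe_injective hab)) ?_
    intro a ha
    simp only [Set.mem_ofPred_eq, ne_eq, Set.mem_preimage] at ha ⊢
    split_ifs at ha with hle
    · rw [List.getElem?_eq_none_iff] at ha
      omega
    · exact absurd rfl ha

/-- The heap `h[u := v]`. -/
def update (h : Heap) (u : ℕ+) (v : ℤ) : Heap where
  cells := Function.update h.cells u (some v)
  finite_alloc := by
    refine (h.finite_alloc.insert u).subset ?_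
    intro a ha
    by_cases hau : a = u
    · exact Or.inl hau
    · refine Or.inr ?_
      simpa [Function.update_of_ne hau] using ha

/-- The addresses `u` at which a block of `n` cells can be allocated: none of
`u, u + 1, …, u + n - 1` is in use. -/
def avail (h : Heap) (n : ℕ) : Set ℕ+ :=
  {u | ∀ a : ℕ+, (u : ℕ) ≤ (a : ℕ) → (a : ℕ) < (u : ℕ) + n → a ∉ h.dom}

end Heap

/-- Program states. -/
abbrev State (V : Type*) : Type _ := Stack V × Heap

/-- Arithmetic expressions, represented by their evaluation; they do not depend on the heap. -/
abbrev AExpr (V : Type*) : Type _ := Stack V → ℤ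

/-- Guards, represented by their evaluation; they do not depend on the heap. -/
abbrev Guard (V : Type*) : Type _ := Stack V → Bool

/-! ### Programs -/

/-- Heap-manipulating probabilistic programs. -/
inductive Prog (V : Type*) where
  /-- The effectless program. -/
  | skip : Prog V
  /-- `x := e` -/
  | assign (x : V) (e : AExpr V) : Prog V
  /-- `c₁ ; c₂` -/
  | seq (c₁ c₂ : Prog V) : Prog V
  /-- `if (b) {c₁} else {c₂}` -/
  | cond (b : Guard V) (c₁ c₂ : Prog V) : Prog V
  /-- `while (b) {c}` -/
  | loop (b : Guard V) (c : Prog V) : Prog V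
  /-- `{c₁} [p] {c₂}` with a rational probability `p` -/
  | choice (c₁ : Prog V) (p : Set.Icc (0 : ℚ) 1) (c₂ : Prog V) : Prog V
  /-- `x := new(e₁, …, eₙ)` where `n ≥ 1` -/
  | alloc (x : V) (es : List (AExpr V)) (hes : es ≠ []) : Prog V
  /-- `<e> := e'` -/
  | mutate (e e' : AExpr V) : Prog V
  /-- `x := <e>` -/
  | lookup (x : V) (e : AExpr V) : Prog V
  /-- `free(e)` -/
  | free (e : AExpr V) : Prog V

/-! ### Operational semantics -/

/-- What remains to be done: a program, or successful termination, or a memory fault. -/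
inductive Control (V : Type*) where
  | run (c : Prog V) : Control V
  | term : Control V
  | fault : Control V

/-- Program configurations. -/
abbrev Conf (V : Type*) : Type _ := Control V × State V

/-- Labels that tell the two branches of a probabilistic choice apart, so that the steps with
probabilities `p` and `1 - p` are counted separately even if `p = 1 - p` and both branches lead to
the same configuration. All other steps are labelled `only`. -/
inductive Branch where
  | only | left | right

/-- The execution relation: `Step t n k p t'` says that in configuration `t` there is an execution
step with action `n` and probability `p` (and branch label `k`) to configuration `t'`. -/
inductive Step {V : Type*} [DecidableEq V] :
    Conf V → ℕ → Branch → ℚ → Conf V → Prop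
  | skip (s : Stack V) (h : Heap) :
      Step (.run .skip, (s, h)) 0 .only 1 (.term, (s, h))
  | assign (x : V) (e : AExpr V) (s : Stack V) (h : Heap) :
      Step (.run (.assign x e), (s, h)) 0 .only 1 (.term, (Function.update s x (e s), h))
  | seq_fault (c₁ c₂ : Prog V) (s : Stack V) (h : Heap) (a : ℕ) (k : Branch) (p : ℚ) :
      Step (.run c₁, (s, h)) a k p (.fault, (s, h)) →
      Step (.run (.seq c₁ c₂), (s, h)) a k p (.fault, (s, h))
  | seq_term (c₁ c₂ : Prog V) (s : Stack V) (h : Heap) (a : ℕ) (k : Branch) (p : ℚ)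
      (s' : Stack V) (h' : Heap) :
      Step (.run c₁, (s, h)) a k p (.term, (s', h')) →
      Step (.run (.seq c₁ c₂), (s, h)) a k p (.run c₂, (s', h'))
  | seq_run (c₁ c₂ c₁' : Prog V) (s : Stack V) (h : Heap) (a : ℕ) (k : Branch) (p : ℚ)
      (s' : Stack V) (h' : Heap) :
      Step (.run c₁, (s, h)) a k p (.run c₁', (s', h')) →
      Step (.run (.seq c₁ c₂), (s, h)) a k p (.run (.seq c₁' c₂), (s', h'))
  | cond_true (b : Guard V) (c₁ c₂ : Prog V) (s : Stack V) (h : Heap) :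
      b s = true →
      Step (.run (.cond b c₁ c₂), (s, h)) 0 .only 1 (.run c₁, (s, h))
  | cond_false (b : Guard V) (c₁ c₂ : Prog V) (s : Stack V) (h : Heap) :
      b s = false →
      Step (.run (.cond b c₁ c₂), (s, h)) 0 .only 1 (.run c₂, (s, h))
  | loop_false (b : Guard V) (c : Prog V) (s : Stack V) (h : Heap) :
      b s = false →
      Step (.run (.loop b c), (s, h)) 0 .only 1 (.term, (s, h))
  | loop_true (b : Guard V) (c : Prog V) (s : Stack V) (h : Heap) :
      b s = true →
      Step (.run (.loop b c), (s, h)) 0 .only 1 (.run (.seq c (.loop b c)), (s, h))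
  | choice_left (c₁ : Prog V) (p : Set.Icc (0 : ℚ) 1) (c₂ : Prog V) (s : Stack V) (h : Heap) :
      Step (.run (.choice c₁ p c₂), (s, h)) 0 .left (p : ℚ) (.run c₁, (s, h))
  | choice_right (c₁ : Prog V) (p : Set.Icc (0 : ℚ) 1) (c₂ : Prog V) (s : Stack V) (h : Heap) :
      Step (.run (.choice c₁ p c₂), (s, h)) 0 .right (1 - (p : ℚ)) (.run c₂, (s, h))
  | alloc (x : V) (es : List (AExpr V)) (hes : es ≠ []) (s : Stack V) (h : Heap) (u : ℕ+) :
      u ∈ h.avail es.length →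
      Step (.run (.alloc x es hes), (s, h)) (u : ℕ) .only 1
        (.term, (Function.update s x ((u : ℕ) : ℤ),
          h.union (Heap.block u (es.map fun e => e s))))
  | mutate (e e' : AExpr V) (s : Stack V) (h : Heap) (u : ℕ+) :
      e s = ((u : ℕ) : ℤ) → u ∈ h.dom →
      Step (.run (.mutate e e'), (s, h)) 0 .only 1 (.term, (s, h.update u (e' s)))
  | mutate_fault (e e' : AExpr V) (s : Stack V) (h : Heap) :
      (∀ u ∈ h.dom, e s ≠ ((u : ℕ) : ℤ)) →
      Step (.run (.mutate e e'), (s, h)) 0 .only 1 (.fault, (s, h))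
  | lookup (x : V) (e : AExpr V) (s : Stack V) (h : Heap) (u : ℕ+) (v : ℤ) :
      e s = ((u : ℕ) : ℤ) → h.cells u = some v →
      Step (.run (.lookup x e), (s, h)) 0 .only 1 (.term, (Function.update s x v, h))
  | lookup_fault (x : V) (e : AExpr V) (s : Stack V) (h : Heap) :
      (∀ u ∈ h.dom, e s ≠ ((u : ℕ) : ℤ)) →
      Step (.run (.lookup x e), (s, h)) 0 .only 1 (.fault, (s, h))
  | free (e : AExpr V) (s : Stack V) (h : Heap) (u : ℕ+) (v : ℤ) :
      e s = ((u : ℕ) : ℤ) → h.Disj (Heap.block u [v]) →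
      Step (.run (.free e), (s, h.union (Heap.block u [v]))) 0 .only 1 (.term, (s, h))
  | free_fault (e : AExpr V) (s : Stack V) (h : Heap) :
      (∀ u ∈ h.dom, e s ≠ ((u : ℕ) : ℤ)) →
      Step (.run (.free e), (s, h)) 0 .only 1 (.fault, (s, h))

/-- Expectations: maps from states to nonnegative reals or infinity, ordered pointwise. -/
abbrev Expectation (V : Type*) : Type _ := State V → ℝ≥0∞

/-- A (nonnegative) rational number as an extended nonnegative real. -/
noncomputable def weight (q : ℚ) : ℝ≥0∞ := ENNReal.ofReal (q : ℝ)

open Classical in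
/-- The total probability of the execution steps from `t` to `t'` with action `n`. -/
noncomputable def prob {V : Type*} [DecidableEq V] (t : Conf V) (n : ℕ) (t' : Conf V) : ℝ≥0∞ :=
  ∑' kp : Branch × ℚ, if Step t n kp.1 kp.2 t' then weight kp.2 else 0

/-- The actions available at a configuration. -/
def enabled {V : Type*} [DecidableEq V] (t : Conf V) : Set ℕ :=
  {n | ∃ (k : Branch) (p : ℚ) (t' : Conf V), 0 < p ∧ Step t n k p t'}

/-- Schedulers map the nonempty finite sequence of configurations visited so far to the next
action, which has to be available at the last of them, if any action is. The sequence
`t₁, …, tₘ` is passed as the list `[t₁, …, tₘ₋₁]` and the current configuration `tₘ`. -/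
structure Scheduler (V : Type*) [DecidableEq V] where
  act : List (Conf V) → Conf V → ℕ
  act_mem : ∀ (past : List (Conf V)) (t : Conf V), (enabled t).Nonempty → act past t ∈ enabled t

/-- `IsGoalPath ρ past t rest`: after the history `past`, the sequence `t :: rest` is a path under
the scheduler `ρ` (all of its steps have positive probability) that ends in a configuration of
successful termination. -/
def IsGoalPath {V : Type*} [DecidableEq V] (ρ : Scheduler V) :
    List (Conf V) → Conf V → List (Conf V) → Prop
  | _, t, [] => t.1 = Control.term
  | past, t, t' :: rest =>
      0 < prob t (ρ.act past t) t' ∧ IsGoalPath ρ (past ++ [t]) t' rest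

/-- The product of the transition probabilities along `t :: rest` after the history `past`. -/
noncomputable def pathProb {V : Type*} [DecidableEq V] (ρ : Scheduler V) :
    List (Conf V) → Conf V → List (Conf V) → ℝ≥0∞
  | _, _, [] => 1
  | past, t, t' :: rest =>
      prob t (ρ.act past t) t' * pathProb ρ (past ++ [t]) t' rest

/-- The reward of a configuration: `X` upon successful termination, zero otherwise. -/
def reward {V : Type*} (X : Expectation V) : Conf V → ℝ≥0∞
  | (.term, σ) => X σ
  | (.run _, _) => 0
  | (.fault, _) => 0

/-- The expected reward of successful termination from `t` under the scheduler `ρ`: the sum, over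
all finite paths `t :: rest` to a goal configuration, of the probability of the path times the
reward of its last configuration. -/
noncomputable def expRewardOf {V : Type*} [DecidableEq V] (X : Expectation V) (ρ : Scheduler V)
    (t : Conf V) : ℝ≥0∞ :=
  ∑' rest : {rest : List (Conf V) // IsGoalPath ρ [] t rest},
    pathProb ρ [] t rest.1 * reward X ((t :: rest.1).getLast (List.cons_ne_nil _ _))

/-- The minimal expected reward of successful termination: the infimum over all schedulers. -/
noncomputable def expReward {V : Type*} [DecidableEq V] (X : Expectation V) (t : Conf V) : ℝ≥0∞ :=
  ⨅ ρ : Scheduler V, expRewardOf X ρ t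

/-! ### Quantitative separation logic -/

open Classical in
/-- The Iverson bracket of a predicate on states. -/
noncomputable def iverson {V : Type*} (φ : State V → Prop) : Expectation V :=
  fun σ => if φ σ then 1 else 0

/-- The predicate `e ↦ e₁, …, eₙ`: the heap consists of exactly the cells with addresses
`e, …, e + n - 1` and contents `e₁, …, eₙ`. -/
def pointsTo {V : Type*} (e : AExpr V) (es : List (AExpr V)) : State V → Prop :=
  fun σ => ∃ u : ℕ+, e σ.1 = ((u : ℕ) : ℤ) ∧ σ.2 = Heap.block u (es.map fun e' => e' σ.1)

/-- The predicate `e ↦ -`: the heap consists of a single cell with address `e`. -/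
def allocated {V : Type*} (e : AExpr V) : State V → Prop :=
  fun σ => ∃ u : ℕ+, e σ.1 = ((u : ℕ) : ℤ) ∧ σ.2.dom = {u}

/-- Quantitative separating conjunction (there are finitely many partitions of a heap, so the
supremum is a maximum). -/
noncomputable def sepCon {V : Type*} (X Y : Expectation V) : Expectation V :=
  fun σ => ⨆ (h₁ : Heap) (h₂ : Heap) (_ : h₁.Disj h₂ ∧ σ.2 = h₁.union h₂),
    X (σ.1, h₁) * Y (σ.1, h₂)

/-- Quantitative separating implication from a predicate to an expectation. -/
noncomputable def sepImp {V : Type*} (φ : State V → Prop) (X : Expectation V) : Expectation V :=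
  fun σ => ⨅ (h' : Heap) (_ : h'.Disj σ.2 ∧ φ (σ.1, h')), X (σ.1, σ.2.union h')

/-- The expectation `X[x := e]`. -/
def subst {V : Type*} [DecidableEq V] (X : Expectation V) (x : V) (e : AExpr V) : Expectation V :=
  fun σ => X (Function.update σ.1 x (e σ.1), σ.2)

theorem sepCon_mono_right {V : Type*} (X : Expectation V) : Monotone (sepCon X) := by
  intro Y Z hYZ σ
  exact iSup_mono fun h₁ => iSup_mono fun h₂ => iSup_mono fun _ => by
    gcongr
    exact hYZ _

theorem sepImp_mono {V : Type*} (φ : State V → Prop) : Monotone (sepImp φ) := by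
  intro Y Z hYZ σ
  exact iInf_mono fun h' => iInf_mono fun _ => hYZ _

theorem subst_mono {V : Type*} [DecidableEq V] (x : V) (e : AExpr V) :
    Monotone fun X : Expectation V => subst X x e :=
  fun _ _ hYZ _ => hYZ _

/-! ### Weakest preexpectations -/

/-- The characteristic function `Y ↦ [¬b] * X + [b] * T Y` of a loop with guard `b`, whose body has
the (monotone) expectation transformer `T`, with respect to the postexpectation `X`. -/
noncomputable def charFun {V : Type*} (b : Guard V) (T : Expectation V →o Expectation V)
    (X : Expectation V) : Expectation V →o Expectation V where
  toFun Y := iverson (fun σ => ¬ b σ.1 = true) * X + iverson (fun σ => b σ.1 = true) * T Y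
  monotone' := by
    intro Y Z hYZ σ
    have := T.monotone hYZ σ
    simp only [Pi.add_apply, Pi.mul_apply]
    gcongr

/-- The weakest preexpectation transformer, bundled with its monotonicity. Loops are given by least
fixed points in the complete lattice of expectations. -/
noncomputable def wp {V : Type*} [DecidableEq V] : Prog V → (Expectation V →o Expectation V)
  | .skip => OrderHom.id
  | .assign x e => ⟨fun X => subst X x e, subst_mono x e⟩
  | .seq c₁ c₂ => (wp c₁).comp (wp c₂)
  | .cond b c₁ c₂ =>
      { toFun := fun X =>
          iverson (fun σ => b σ.1 = true) * wp c₁ X + iverson (fun σ => ¬ b σ.1 = true) * wp c₂ X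
        monotone' := by
          intro Y Z hYZ σ
          have h₁ := (wp c₁).monotone hYZ σ
          have h₂ := (wp c₂).monotone hYZ σ
          simp only [Pi.add_apply, Pi.mul_apply]
          gcongr }
  | .loop b c =>
      { toFun := fun X => OrderHom.lfp (charFun b (wp c) X)
        monotone' := by
          intro Y Z hYZ
          refine OrderHom.lfp.monotone ?_
          intro W σ
          change iverson _ σ * Y σ + iverson _ σ * wp c W σ ≤
            iverson _ σ * Z σ + iverson _ σ * wp c W σ
          have := hYZ σ
          gcongr }
  | .choice c₁ p c₂ =>
      { toFun := fun X σ => weight (p : ℚ) * wp c₁ X σ + weight (1 - (p : ℚ)) * wp c₂ X σ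
        monotone' := by
          intro Y Z hYZ σ
          have h₁ := (wp c₁).monotone hYZ σ
          have h₂ := (wp c₂).monotone hYZ σ
          dsimp only
          gcongr }
  | .alloc x es _ =>
      { toFun := fun X σ => ⨅ v ∈ σ.2.avail es.length,
          sepImp (pointsTo (fun _ => ((v : ℕ) : ℤ)) es) (subst X x fun _ => ((v : ℕ) : ℤ)) σ
        monotone' := fun _ _ hYZ _ => iInf_mono fun _ => iInf_mono fun _ =>
          sepImp_mono _ (subst_mono x _ hYZ) _ }
  | .mutate e e' =>
      { toFun := fun X => sepCon (iverson (allocated e)) (sepImp (pointsTo e [e']) X)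
        monotone' := fun _ _ hYZ => sepCon_mono_right _ (sepImp_mono _ hYZ) }
  | .lookup x e =>
      { toFun := fun X => ⨆ v : ℤ, sepCon (iverson (pointsTo e [fun _ => v]))
          (sepImp (pointsTo e [fun _ => v]) (subst X x fun _ => v))
        monotone' := fun _ _ hYZ => iSup_mono fun _ =>
          sepCon_mono_right _ (sepImp_mono _ (subst_mono x _ hYZ)) }
  | .free e =>
      { toFun := fun X => sepCon (iverson (allocated e)) X
        monotone' := sepCon_mono_right _ }

end HPGCL

/-! Both sides are the least solution of one system of optimality inequalities. Call a valuation `F`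
of configurations a super-solution if it dominates `X` at termination and, at every running
configuration, its least one-step expected value over the available actions (`IsSuperSolution`;
nothing is asked of faults).

Minimal expected rewards form a super-solution by splitting off the first step, since what a
scheduler does after some history is again done by a scheduler (`isSuperSolution_expReward`). They
lie below any super-solution `F` (`IsSuperSolution.expReward_le`). The infimum over the infinitely
many allocation addresses need not be attained, so the scheduler picks actions that are optimal for
`F` up to errors halving with each step; the total loss is at most `ε`.

Weakest preexpectations satisfy the optimality equations exactly (`wp_apply_eq_minExpect`): heap
operations have a unique relevant heap splitting, and sequencing is a relabelling of steps. They
also lie below any super-solution (`IsSuperSolution.wp_le`), by induction on the program. For `c₁;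
c₂` the super-solution is restricted to configurations of the form `t; c₂`; for loops it yields a
prefixed point of the characteristic function.

Applying each minimality statement to the other super-solution gives the two inequalities. -/

namespace HPGCL

/-! ### Algebra of heaps: unions, blocks, erasing a cell. -/

namespace Heap

theorem mem_dom {h : Heap} {a : ℕ+} : a ∈ h.dom ↔ h.cells a ≠ none := Iff.rfl

theorem notMem_dom {h : Heap} {a : ℕ+} : a ∉ h.dom ↔ h.cells a = none := by
  simp [mem_dom]

theorem cells_union (h₁ h₂ : Heap) (a : ℕ+) :
    (h₁.union h₂).cells a = (h₁.cells a).or (h₂.cells a) := rfl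

theorem Disj.cells_eq_none {h₁ h₂ : Heap} (hd : h₁.Disj h₂) (a : ℕ+) :
    h₁.cells a = none ∨ h₂.cells a = none := by
  by_contra! hc
  exact Set.disjoint_left.mp hd hc.1 hc.2

theorem Disj.symm {h₁ h₂ : Heap} (hd : h₁.Disj h₂) : h₂.Disj h₁ := Disjoint.symm hd

theorem union_comm {h₁ h₂ : Heap} (hd : h₁.Disj h₂) : h₁.union h₂ = h₂.union h₁ := by
  ext1
  funext a
  rw [cells_union, cells_union]
  rcases hd.cells_eq_none a with h | h <;> simp [h]

theorem dom_subset_union_left (h₁ h₂ : Heap) : h₁.dom ⊆ (h₁.union h₂).dom := by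
  intro a ha
  rw [mem_dom] at ha ⊢
  rw [cells_union]
  cases hc : h₁.cells a <;> simp_all

theorem mem_dom_block {u a : ℕ+} {vs : List ℤ} :
    a ∈ (block u vs).dom ↔ (u : ℕ) ≤ a ∧ (a : ℕ) < u + vs.length := by
  simp only [mem_dom, block]
  split_ifs with h
  · simp only [ne_eq, List.getElem?_eq_none_iff, not_le, h, true_and]
    omega
  · simp [h]

theorem cells_block_singleton (u a : ℕ+) (v : ℤ) :
    (block u [v]).cells a = if a = u then some v else none := by
  by_cases h : a = u
  · subst h
    simp [block]
  · have h' : (a : ℕ) ≠ u := fun hc => h (PNat.coe_injective hc)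
    simp only [block, h, if_false]
    split_ifs with hle
    · rw [List.getElem?_eq_none_iff, List.length_singleton]
      omega
    · rfl

theorem dom_block_singleton (u : ℕ+) (v : ℤ) : (block u [v]).dom = {u} := by
  ext a
  rw [mem_dom, cells_block_singleton]
  simp

theorem disj_block {h : Heap} {u : ℕ+} {vs : List ℤ} (hu : u ∈ h.avail vs.length) :
    (block u vs).Disj h :=
  Set.disjoint_left.mpr fun a ha => by
    rw [mem_dom_block] at ha
    exact hu a ha.1 ha.2

/-- Heaps are finite, so everything above the largest used address is free. Hence allocation never
blocks. -/
theorem avail_nonempty (h : Heap) (n : ℕ) : (h.avail n).Nonempty := by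
  obtain ⟨m, hm⟩ := (show h.dom.Finite from h.finite_alloc).bddAbove
  refine ⟨m + 1, fun a ha _ hmem => ?_⟩
  have : (a : ℕ) ≤ m := hm hmem
  rw [PNat.add_coe, PNat.one_coe] at ha
  omega

/-- The heap `h` with the cell `u` removed. -/
def erase (h : Heap) (u : ℕ+) : Heap where
  cells := Function.update h.cells u none
  finite_alloc := by
    refine h.finite_alloc.subset fun a ha => ?_
    by_cases hau : a = u
    · subst hau
      simp at ha
    · simpa [Function.update_of_ne hau] using ha

theorem cells_erase (h : Heap) (u a : ℕ+) :
    (h.erase u).cells a = if a = u then none else h.cells a := by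
  simp [erase, Function.update_apply]

theorem cells_update (h : Heap) (u a : ℕ+) (v : ℤ) :
    (h.update u v).cells a = if a = u then some v else h.cells a := by
  simp [update, Function.update_apply]

theorem disj_erase_of_dom {h h₁ : Heap} {u : ℕ+} (h1 : h₁.dom = {u}) : h₁.Disj (h.erase u) := by
  rw [Disj, h1, Set.disjoint_singleton_left, notMem_dom]
  simp [cells_erase]

/-- This identity turns the pattern "split off a cell, then add it back with new contents" in `wp`
for mutation and lookup into a heap update. -/
theorem erase_union_block (h : Heap) (u : ℕ+) (v : ℤ) :
    (h.erase u).union (block u [v]) = h.update u v := by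
  ext1
  funext a
  rw [cells_union, cells_erase, cells_block_singleton, cells_update]
  split_ifs <;> simp

theorem update_eq_self {h : Heap} {u : ℕ+} {v : ℤ} (hv : h.cells u = some v) :
    h.update u v = h := by
  ext1
  funext a
  rw [cells_update]
  split_ifs with ha
  · rw [ha, hv]
  · rfl

/-- The remainder of a splitting is determined by the address of the cell split off, which makes the
maximum in `sepCon` range over a single relevant term. -/
theorem eq_erase_of_union {h₁ h₂ : Heap} {u : ℕ+} (hd : h₁.Disj h₂) (h1 : h₁.dom = {u}) :
    h₂ = (h₁.union h₂).erase u := by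
  ext1
  funext a
  rw [cells_erase, cells_union]
  split_ifs with ha
  · have : h₁.cells a ≠ none := by
      rw [← mem_dom, h1, ha]
      rfl
    exact (hd.cells_eq_none a).resolve_left this
  · have : h₁.cells a = none := by
      rw [← notMem_dom, h1]
      exact ha
    simp [this]

theorem mem_dom_union_block (h : Heap) (u : ℕ+) (v : ℤ) :
    u ∈ (h.union (Heap.block u [v])).dom := by
  rw [Heap.mem_dom, Heap.cells_union, Heap.cells_block_singleton]
  simp

end Heap

variable {V : Type*}

/-! ### Separating connectives -/

theorem address_unique {z : ℤ} {u w : ℕ+} (hu : z = ((u : ℕ) : ℤ)) (hw : z = ((w : ℕ) : ℤ)) :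
    u = w :=
  PNat.coe_injective (by exact_mod_cast hu.symm.trans hw)

theorem allocated_iff {e : AExpr V} {s : Stack V} {h : Heap} {u : ℕ+} (he : e s = ((u : ℕ) : ℤ)) :
    allocated e (s, h) ↔ h.dom = {u} := by
  constructor
  · rintro ⟨w, hw, hd⟩
    have : w = u := address_unique hw he
    rwa [← this]
  · exact fun hd => ⟨u, he, hd⟩

theorem pointsTo_iff {e : AExpr V} {es : List (AExpr V)} {s : Stack V} {h : Heap} {u : ℕ+}
    (he : e s = ((u : ℕ) : ℤ)) :
    pointsTo e es (s, h) ↔ h = Heap.block u (es.map fun e' => e' s) := by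
  constructor
  · rintro ⟨w, hw, hd⟩
    have : w = u := address_unique hw he
    rwa [← this]
  · exact fun hd => ⟨u, he, hd⟩

/-- A points-to predicate is satisfied by exactly one heap for a given stack, so the infimum has a
single member. -/
theorem sepImp_pointsTo {e : AExpr V} {es : List (AExpr V)} {s : Stack V} {h : Heap} {u : ℕ+}
    (X : Expectation V) (he : e s = ((u : ℕ) : ℤ))
    (hd : (Heap.block u (es.map fun e' => e' s)).Disj h) :
    sepImp (pointsTo e es) X (s, h) = X (s, h.union (Heap.block u (es.map fun e' => e' s))) := by
  refine le_antisymm (iInf₂_le_of_le _ ⟨hd, (pointsTo_iff he).mpr rfl⟩ le_rfl) ?_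
  refine le_iInf₂ fun h' hh' => ?_
  rw [(pointsTo_iff he).mp hh'.2]

/-- Splittings violating `φ` contribute zero, and all others share the same remainder. -/
theorem sepCon_iverson_of_unique {φ : State V → Prop} {Y : Expectation V} {s : Stack V}
    {h h₁ h₂ : Heap} (hφ : φ (s, h₁)) (hd : h₁.Disj h₂) (hh : h = h₁.union h₂)
    (huniq : ∀ h₁' h₂' : Heap, φ (s, h₁') → h₁'.Disj h₂' → h = h₁'.union h₂' → h₂' = h₂) :
    sepCon (iverson φ) Y (s, h) = Y (s, h₂) := by
  refine le_antisymm ?_ ?_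
  · refine iSup₂_le fun h₁' h₂' => iSup_le fun hh' => ?_
    by_cases hφ' : φ (s, h₁')
    · simp [iverson, hφ', huniq _ _ hφ' hh'.1 hh'.2]
    · simp [iverson, hφ']
  · refine le_iSup₂_of_le h₁ h₂ (le_iSup_of_le ⟨hd, hh⟩ ?_)
    simp [iverson, hφ]

theorem sepCon_iverson_eq_zero {φ : State V → Prop} {Y : Expectation V} {s : Stack V}
    {h : Heap} (hφ : ∀ h₁ h₂ : Heap, h₁.Disj h₂ → h = h₁.union h₂ → ¬ φ (s, h₁)) :
    sepCon (iverson φ) Y (s, h) = 0 := by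
  refine le_antisymm ?_ zero_le
  refine iSup₂_le fun h₁ h₂ => iSup_le fun hh => ?_
  simp [iverson, hφ h₁ h₂ hh.1 hh.2]

theorem eq_block_union_erase {h : Heap} {u : ℕ+} {v : ℤ} (hv : h.cells u = some v) :
    h = (Heap.block u [v]).union (h.erase u) := by
  rw [Heap.union_comm (Heap.disj_erase_of_dom (Heap.dom_block_singleton u v)),
    Heap.erase_union_block, Heap.update_eq_self hv]

theorem sepCon_allocated {e : AExpr V} {s : Stack V} {h : Heap} {u : ℕ+} (Y : Expectation V)
    (he : e s = ((u : ℕ) : ℤ)) (hu : u ∈ h.dom) :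
    sepCon (iverson (allocated e)) Y (s, h) = Y (s, h.erase u) := by
  obtain ⟨v, hv⟩ := Option.ne_none_iff_exists'.mp hu
  refine sepCon_iverson_of_unique (h₁ := Heap.block u [v])
    ((allocated_iff he).mpr (Heap.dom_block_singleton u v))
    (Heap.disj_erase_of_dom (Heap.dom_block_singleton u v)) (eq_block_union_erase hv) ?_
  intro h₁' h₂' hφ hd hh
  rw [hh]
  exact Heap.eq_erase_of_union hd ((allocated_iff he).mp hφ)

theorem sepCon_allocated_fault {e : AExpr V} {s : Stack V} {h : Heap} (Y : Expectation V)
    (hf : ∀ u ∈ h.dom, e s ≠ ((u : ℕ) : ℤ)) :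
    sepCon (iverson (allocated e)) Y (s, h) = 0 := by
  refine sepCon_iverson_eq_zero ?_
  rintro h₁ h₂ - rfl ⟨u, hu, hdom⟩
  refine hf u (Heap.dom_subset_union_left _ _ ?_) hu
  rw [show h₁.dom = {u} from hdom]
  rfl

theorem sepCon_pointsTo {e : AExpr V} {s : Stack V} {h : Heap} {u : ℕ+} {v : ℤ}
    (Y : Expectation V) (he : e s = ((u : ℕ) : ℤ)) (hv : h.cells u = some v) :
    sepCon (iverson (pointsTo e [fun _ => v])) Y (s, h) = Y (s, h.erase u) := by
  refine sepCon_iverson_of_unique (h₁ := Heap.block u [v]) ((pointsTo_iff he).mpr rfl)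
    (Heap.disj_erase_of_dom (Heap.dom_block_singleton u v)) (eq_block_union_erase hv) ?_
  intro h₁' h₂' hφ hd hh
  rw [hh]
  refine Heap.eq_erase_of_union hd ?_
  rw [(pointsTo_iff he).mp hφ]
  exact Heap.dom_block_singleton u v

theorem sepCon_pointsTo_eq_zero {e : AExpr V} {s : Stack V} {h : Heap} {v : ℤ}
    (Y : Expectation V) (hf : ∀ u : ℕ+, e s = ((u : ℕ) : ℤ) → h.cells u ≠ some v) :
    sepCon (iverson (pointsTo e [fun _ => v])) Y (s, h) = 0 := by
  refine sepCon_iverson_eq_zero ?_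
  rintro h₁ h₂ - rfl ⟨u, hu, hb⟩
  refine hf u hu ?_
  rw [Heap.cells_union, show h₁ = Heap.block u [v] from hb, Heap.cells_block_singleton]
  simp

theorem mem_dom_or_fault (e : AExpr V) (s : Stack V) (h : Heap) :
    (∃ u ∈ h.dom, e s = ((u : ℕ) : ℤ)) ∨ ∀ u ∈ h.dom, e s ≠ ((u : ℕ) : ℤ) := by
  by_cases H : ∃ u ∈ h.dom, e s = ((u : ℕ) : ℤ)
  · exact Or.inl H
  · exact Or.inr (by push Not at H; exact H)

theorem sepImp_erase {e e' : AExpr V} {s : Stack V} {h : Heap} {u : ℕ+} (X : Expectation V)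
    (he : e s = ((u : ℕ) : ℤ)) :
    sepImp (pointsTo e [e']) X (s, h.erase u) = X (s, h.update u (e' s)) := by
  rw [sepImp_pointsTo X he]
  · simp [Heap.erase_union_block]
  · exact Heap.disj_erase_of_dom (Heap.dom_block_singleton _ _)

theorem charFun_apply (b : Guard V) (T : Expectation V →o Expectation V) (X Y : Expectation V)
    (σ : State V) : charFun b T X Y σ = if b σ.1 = true then T Y σ else X σ := by
  change iverson (fun σ => ¬ b σ.1 = true) σ * X σ
    + iverson (fun σ => b σ.1 = true) σ * T Y σ = _
  by_cases h : b σ.1 = true <;> simp [iverson, h]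

/-! ### Sequencing of configurations -/

/-- The configuration `t ; c`, with `⇓ ; c` read as `c` and `⚡ ; c` as `⚡`. -/
def andThen (c : Prog V) : Conf V → Conf V
  | (.run c', σ) => (.run (.seq c' c), σ)
  | (.term, σ) => (.run c, σ)
  | (.fault, σ) => (.fault, σ)

/-- By size. This keeps the images of running and terminated configurations under `andThen c` apart.
-/
theorem seq_ne_right (c c' : Prog V) : Prog.seq c' c ≠ c := by
  intro h
  have := congrArg sizeOf h
  simp only [Prog.seq.sizeOf_spec] at this
  omega

/-- Injectivity ensures that distinct steps of `c₁` remain distinct steps of `c₁; c₂`, so that sums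
over steps can be transported. -/
theorem andThen_injective (c : Prog V) : Function.Injective (andThen c) := by
  rintro ⟨_ | _ | _, σ⟩ ⟨_ | _ | _, σ'⟩ h <;>
    simp only [andThen, Prod.mk.injEq, Control.run.injEq, Prog.seq.injEq, reduceCtorEq, true_and,
      false_and, and_true, seq_ne_right, (seq_ne_right _ _).symm] at h ⊢ <;> exact h

variable [DecidableEq V]

/-! ### Transitions -/

theorem weight_one : weight 1 = 1 := by simp [weight]

theorem weight_add_weight_one_sub (p : Set.Icc (0 : ℚ) 1) :
    weight (p : ℚ) + weight (1 - (p : ℚ)) = 1 := by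
  have h0 : (0 : ℝ) ≤ ((p : ℚ) : ℝ) := by exact_mod_cast p.2.1
  have h1 : (0 : ℝ) ≤ ((1 - (p : ℚ) : ℚ) : ℝ) := by exact_mod_cast sub_nonneg.mpr p.2.2
  rw [weight, weight, ← ENNReal.ofReal_add h0 h1]
  push_cast
  simp

/-- The steps from `t` with action `a`: branch labels, probabilities and targets. -/
def steps (t : Conf V) (a : ℕ) : Set (Branch × ℚ × Conf V) :=
  {x | Step t a x.1 x.2.1 x.2.2}

/-- The expected value of `F` after a step from `t` with action `a`. -/
noncomputable def expect (t : Conf V) (a : ℕ) (F : Conf V → ℝ≥0∞) : ℝ≥0∞ :=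
  ∑' t', prob t a t' * F t'

/-- The least expected value of `F` after a step from `t`, over all available actions. -/
noncomputable def minExpect (t : Conf V) (F : Conf V → ℝ≥0∞) : ℝ≥0∞ :=
  ⨅ a ∈ enabled t, expect t a F

/-- Exchanging the sums over targets and over labelled probabilities replaces `prob` by a sum over
individual steps, which case analysis on `Step` can compute. -/
theorem expect_eq_tsum_steps (t : Conf V) (a : ℕ) (F : Conf V → ℝ≥0∞) :
    expect t a F = ∑' x : steps t a, weight x.1.2.1 * F x.1.2.2 := by
  classical
  rw [tsum_subtype (steps t a) fun x : Branch × ℚ × Conf V => weight x.2.1 * F x.2.2]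
  rw [← (Equiv.prodAssoc Branch ℚ (Conf V)).tsum_eq]
  refine Eq.trans ?_ (ENNReal.tsum_prod (f := fun (kp : Branch × ℚ) (t' : Conf V) =>
    (steps t a).indicator (fun x => weight x.2.1 * F x.2.2) (kp.1, kp.2, t'))).symm
  rw [ENNReal.tsum_comm]
  refine tsum_congr fun t' => ?_
  rw [prob, ← ENNReal.tsum_mul_right]
  refine tsum_congr fun kp => ?_
  by_cases hs : Step t a kp.1 kp.2 t' <;> simp [Set.indicator, steps, hs]

theorem expect_mono (t : Conf V) (a : ℕ) {F G : Conf V → ℝ≥0∞} (h : F ≤ G) :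
    expect t a F ≤ expect t a G :=
  ENNReal.tsum_le_tsum fun t' => mul_le_mul_right (h t') _

theorem expect_add (t : Conf V) (a : ℕ) (F G : Conf V → ℝ≥0∞) :
    expect t a (fun t' => F t' + G t') = expect t a F + expect t a G := by
  simp only [expect, mul_add, ENNReal.tsum_add]

theorem expect_const (t : Conf V) (a : ℕ) (r : ℝ≥0∞) :
    expect t a (fun _ => r) = expect t a (fun _ => 1) * r := by
  simp only [expect, mul_one, ENNReal.tsum_mul_right]

theorem expect_of_steps_singleton {t : Conf V} {a : ℕ} {k : Branch} {p : ℚ} {t' : Conf V}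
    (h : steps t a = {(k, p, t')}) (F : Conf V → ℝ≥0∞) : expect t a F = weight p * F t' := by
  rw [expect_eq_tsum_steps, h, tsum_singleton (k, p, t') fun x => weight x.2.1 * F x.2.2]

theorem steps_run_choice (c₁ : Prog V) (p : Set.Icc (0 : ℚ) 1) (c₂ : Prog V) (σ : State V) :
    steps (.run (.choice c₁ p c₂), σ) 0 =
      {(.left, (p : ℚ), (.run c₁, σ)), (.right, 1 - (p : ℚ), (.run c₂, σ))} := by
  ext ⟨k, q, t'⟩
  constructor
  · intro hs
    cases (show Step _ _ _ _ _ from hs)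
    · exact Or.inl rfl
    · exact Or.inr rfl
  · rintro (hs | hs)
    · cases hs
      exact Step.choice_left _ _ _ _ _
    · cases hs
      exact Step.choice_right _ _ _ _ _

theorem expect_choice (c₁ : Prog V) (p : Set.Icc (0 : ℚ) 1) (c₂ : Prog V) (σ : State V)
    (F : Conf V → ℝ≥0∞) :
    expect (.run (.choice c₁ p c₂), σ) 0 F =
      weight (p : ℚ) * F (.run c₁, σ) + weight (1 - (p : ℚ)) * F (.run c₂, σ) := by
  -- The two singletons are disjoint because of their branch labels, even if `c₁ = c₂` and `p = 1 -
  -- p`.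
  rw [expect_eq_tsum_steps, steps_run_choice, Set.insert_eq, ENNReal.summable.tsum_union_disjoint
    (f := fun x : Branch × ℚ × Conf V => weight x.2.1 * F x.2.2) ?_ ENNReal.summable,
    tsum_singleton _ fun x : Branch × ℚ × Conf V => weight x.2.1 * F x.2.2,
    tsum_singleton _ fun x : Branch × ℚ × Conf V => weight x.2.1 * F x.2.2]
  simp

theorem enabled_of_steps_zero {t : Conf V} {k : Branch} {t' : Conf V}
    (h : ∀ a, steps t a = {x | a = 0 ∧ x = (k, 1, t')}) : enabled t = {0} := by
  ext a
  constructor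
  · rintro ⟨k', p, t'', -, hs⟩
    have : (k', p, t'') ∈ steps t a := hs
    rw [h] at this
    exact this.1
  · rintro rfl
    refine ⟨k, 1, t', one_pos, ?_⟩
    have : (k, 1, t') ∈ steps t 0 := by
      rw [h]
      exact ⟨rfl, rfl⟩
    exact this

/-- The configuration `t` has exactly one step, which has action `0`, probability `1` and target
`t'`. -/
def StepsTo (t t' : Conf V) : Prop :=
  ∀ a k p t'', Step t a k p t'' ↔ a = 0 ∧ k = .only ∧ p = 1 ∧ t'' = t'

theorem StepsTo.steps_eq {t t' : Conf V} (h : StepsTo t t') (a : ℕ) :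
    steps t a = {x | a = 0 ∧ x = (.only, 1, t')} := by
  ext ⟨k, p, t''⟩
  simp [steps, h a k p t'']

theorem StepsTo.enabled_eq {t t' : Conf V} (h : StepsTo t t') : enabled t = {0} :=
  enabled_of_steps_zero h.steps_eq

theorem StepsTo.expect_zero {t t' : Conf V} (h : StepsTo t t') (F : Conf V → ℝ≥0∞) :
    expect t 0 F = F t' := by
  have : steps t 0 = {(.only, 1, t')} := by
    rw [h.steps_eq]
    simp
  rw [expect_of_steps_singleton this, weight_one, one_mul]

theorem StepsTo.minExpect_eq {t t' : Conf V} (h : StepsTo t t') (F : Conf V → ℝ≥0∞) :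
    minExpect t F = F t' := by
  simp [minExpect, h.enabled_eq, h.expect_zero]

/-! ### Statements with exactly one step. -/

theorem stepsTo_skip (σ : State V) : StepsTo (.run .skip, σ) (.term, σ) := by
  intro a k p t'
  constructor
  · intro hs
    cases hs
    simp
  · rintro ⟨rfl, rfl, rfl, rfl⟩
    exact Step.skip _ _

theorem stepsTo_assign (x : V) (e : AExpr V) (s : Stack V) (h : Heap) :
    StepsTo (.run (.assign x e), (s, h)) (.term, (Function.update s x (e s), h)) := by
  intro a k p t'
  constructor
  · intro hs
    cases hs
    simp
  · rintro ⟨rfl, rfl, rfl, rfl⟩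
    exact Step.assign _ _ _ _

theorem stepsTo_cond (b : Guard V) (c₁ c₂ : Prog V) (s : Stack V) (h : Heap) :
    StepsTo (.run (.cond b c₁ c₂), (s, h))
      (if b s = true then (.run c₁, (s, h)) else (.run c₂, (s, h))) := by
  intro a k p t'
  constructor
  · intro hs
    cases hs with
    | cond_true _ _ _ _ _ hb => simp [hb]
    | cond_false _ _ _ _ _ hb => simp [hb]
  · rintro ⟨rfl, rfl, rfl, rfl⟩
    split_ifs with hb
    · exact Step.cond_true _ _ _ _ _ hb
    · exact Step.cond_false _ _ _ _ _ (by simpa using hb)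

theorem stepsTo_loop (b : Guard V) (c : Prog V) (s : Stack V) (h : Heap) :
    StepsTo (.run (.loop b c), (s, h))
      (if b s = true then (.run (.seq c (.loop b c)), (s, h)) else (.term, (s, h))) := by
  intro a k p t'
  constructor
  · intro hs
    cases hs with
    | loop_true _ _ _ _ hb => simp [hb]
    | loop_false _ _ _ _ hb => simp [hb]
  · rintro ⟨rfl, rfl, rfl, rfl⟩
    split_ifs with hb
    · exact Step.loop_true _ _ _ _ hb
    · exact Step.loop_false _ _ _ _ (by simpa using hb)

theorem stepsTo_mutate {e e' : AExpr V} {s : Stack V} {h : Heap} {u : ℕ+}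
    (he : e s = ((u : ℕ) : ℤ)) (hu : u ∈ h.dom) :
    StepsTo (.run (.mutate e e'), (s, h)) (.term, (s, h.update u (e' s))) := by
  intro a k p t'
  constructor
  · intro hs
    cases hs with
    | mutate _ _ _ _ w hw _ => simp [address_unique he hw]
    | mutate_fault _ _ _ _ hf => exact absurd he (hf u hu)
  · rintro ⟨rfl, rfl, rfl, rfl⟩
    exact Step.mutate _ _ _ _ _ he hu

theorem stepsTo_mutate_fault {e e' : AExpr V} {s : Stack V} {h : Heap}
    (hf : ∀ u ∈ h.dom, e s ≠ ((u : ℕ) : ℤ)) :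
    StepsTo (.run (.mutate e e'), (s, h)) (.fault, (s, h)) := by
  intro a k p t'
  constructor
  · intro hs
    cases hs with
    | mutate _ _ _ _ w hw hmem => exact absurd hw (hf w hmem)
    | mutate_fault _ _ _ _ _ => simp
  · rintro ⟨rfl, rfl, rfl, rfl⟩
    exact Step.mutate_fault _ _ _ _ hf

theorem stepsTo_lookup {x : V} {e : AExpr V} {s : Stack V} {h : Heap} {u : ℕ+} {v : ℤ}
    (he : e s = ((u : ℕ) : ℤ)) (hv : h.cells u = some v) :
    StepsTo (.run (.lookup x e), (s, h)) (.term, (Function.update s x v, h)) := by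
  intro a k p t'
  constructor
  · intro hs
    cases hs with
    | lookup _ _ _ _ w v' hw hv' =>
      rw [← address_unique he hw, hv] at hv'
      simp [Option.some.inj hv']
    | lookup_fault _ _ _ _ hf => exact absurd he (hf u (by simp [Heap.mem_dom, hv]))
  · rintro ⟨rfl, rfl, rfl, rfl⟩
    exact Step.lookup _ _ _ _ _ _ he hv

theorem stepsTo_lookup_fault {x : V} {e : AExpr V} {s : Stack V} {h : Heap}
    (hf : ∀ u ∈ h.dom, e s ≠ ((u : ℕ) : ℤ)) :
    StepsTo (.run (.lookup x e), (s, h)) (.fault, (s, h)) := by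
  intro a k p t'
  constructor
  · intro hs
    cases hs with
    | lookup _ _ _ _ w v hw hv => exact absurd hw (hf w (by simp [Heap.mem_dom, hv]))
    | lookup_fault _ _ _ _ _ => simp
  · rintro ⟨rfl, rfl, rfl, rfl⟩
    exact Step.lookup_fault _ _ _ _ hf

theorem stepsTo_free {e : AExpr V} {s : Stack V} {h : Heap} {u : ℕ+}
    (he : e s = ((u : ℕ) : ℤ)) (hu : u ∈ h.dom) :
    StepsTo (.run (.free e), (s, h)) (.term, (s, h.erase u)) := by
  intro a k p t'
  constructor
  · intro hs
    cases hs with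
    | free _ _ h' w v hw hd =>
      obtain rfl := address_unique he hw
      rw [Heap.union_comm hd, ← Heap.eq_erase_of_union hd.symm (Heap.dom_block_singleton u v)]
      simp
    | free_fault _ _ _ hf => exact absurd he (hf u hu)
  · rintro ⟨rfl, rfl, rfl, rfl⟩
    obtain ⟨v, hv⟩ := Option.ne_none_iff_exists'.mp hu
    -- The rule for `free` presents its source heap as a disjoint union, so `h` is split into
    -- `h.erase u` and the cell at `u`.
    have hd := (Heap.disj_erase_of_dom (h := h) (Heap.dom_block_singleton u v)).symm
    have := Step.free e s (h.erase u) u v he hd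
    rwa [Heap.erase_union_block, Heap.update_eq_self hv] at this

theorem stepsTo_free_fault {e : AExpr V} {s : Stack V} {h : Heap}
    (hf : ∀ u ∈ h.dom, e s ≠ ((u : ℕ) : ℤ)) :
    StepsTo (.run (.free e), (s, h)) (.fault, (s, h)) := by
  intro a k p t'
  constructor
  · intro hs
    cases hs with
    | free _ _ h' w v hw hd => exact absurd hw (hf w (Heap.mem_dom_union_block _ _ _))
    | free_fault _ _ _ _ => simp
  · rintro ⟨rfl, rfl, rfl, rfl⟩
    exact Step.free_fault _ _ _ hf

/-! ### Steps of probabilistic choice and allocation. -/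

theorem enabled_choice (c₁ : Prog V) (p : Set.Icc (0 : ℚ) 1) (c₂ : Prog V) (σ : State V) :
    enabled (.run (.choice c₁ p c₂), σ) = {0} := by
  ext a
  constructor
  · rintro ⟨k, q, t', -, hs⟩
    cases hs <;> rfl
  · rintro rfl
    -- Availability needs positive probability: for `p = 0` only the right branch provides it.
    rcases p.2.1.lt_or_eq with hp | hp
    · exact ⟨_, _, _, hp, Step.choice_left _ _ _ _ _⟩
    · exact ⟨_, _, _, by rw [← hp]; norm_num, Step.choice_right _ _ _ _ _⟩

theorem minExpect_choice (c₁ : Prog V) (p : Set.Icc (0 : ℚ) 1) (c₂ : Prog V) (σ : State V)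
    (F : Conf V → ℝ≥0∞) :
    minExpect (.run (.choice c₁ p c₂), σ) F =
      weight (p : ℚ) * F (.run c₁, σ) + weight (1 - (p : ℚ)) * F (.run c₂, σ) := by
  simp [minExpect, enabled_choice, expect_choice]

/-- The configuration that an allocation of a block at the address `u` leads to. -/
def allocConf (x : V) (es : List (AExpr V)) (σ : State V) (u : ℕ+) : Conf V :=
  (.term, (Function.update σ.1 x ((u : ℕ) : ℤ),
    σ.2.union (Heap.block u (es.map fun e => e σ.1))))

theorem steps_alloc {x : V} {es : List (AExpr V)} {hes : es ≠ []} {σ : State V} {u : ℕ+}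
    (hu : u ∈ σ.2.avail es.length) :
    steps (.run (.alloc x es hes), σ) (u : ℕ) = {(.only, 1, allocConf x es σ u)} := by
  ext ⟨k, p, t'⟩
  constructor
  · intro hs
    have hs' : Step (.run (.alloc x es hes), σ) (u : ℕ) k p t' := hs
    -- Case analysis cannot unify the coercions of two addresses, so the action is made a variable
    -- first.
    generalize ha : (u : ℕ) = a at hs'
    cases hs' with
    | alloc _ _ _ s h w hw =>
      obtain rfl := PNat.coe_injective ha
      rfl
  · intro hs
    cases hs
    exact Step.alloc _ _ _ _ _ _ hu

theorem enabled_alloc (x : V) (es : List (AExpr V)) (hes : es ≠ []) (σ : State V) :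
    enabled (.run (.alloc x es hes), σ) = (fun u : ℕ+ => (u : ℕ)) '' σ.2.avail es.length := by
  ext a
  constructor
  · rintro ⟨k, q, t', -, hs⟩
    cases hs with
    | alloc _ _ _ s h w hw => exact ⟨w, hw, rfl⟩
  · rintro ⟨u, hu, rfl⟩
    exact ⟨_, _, _, one_pos, Step.alloc _ _ _ _ _ _ hu⟩

theorem expect_alloc {x : V} {es : List (AExpr V)} {hes : es ≠ []} {σ : State V} {u : ℕ+}
    (hu : u ∈ σ.2.avail es.length) (F : Conf V → ℝ≥0∞) :
    expect (.run (.alloc x es hes), σ) (u : ℕ) F = F (allocConf x es σ u) := by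
  rw [expect_of_steps_singleton (steps_alloc hu), weight_one, one_mul]

theorem minExpect_alloc (x : V) (es : List (AExpr V)) (hes : es ≠ []) (σ : State V)
    (F : Conf V → ℝ≥0∞) :
    minExpect (.run (.alloc x es hes), σ) F =
      ⨅ u ∈ σ.2.avail es.length, F (allocConf x es σ u) := by
  rw [minExpect, enabled_alloc, iInf_image]
  exact iInf_congr fun u => iInf_congr fun hu => expect_alloc hu F

/-! ### Steps of a sequential composition. -/

theorem Step.state_eq_of_fault {t t' : Conf V} {a : ℕ} {k : Branch} {p : ℚ}
    (hs : Step t a k p t') (hf : t'.1 = .fault) : t'.2 = t.2 := by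
  cases hs <;> first | rfl | cases hf

/-- The three sequencing rules merge into one via `andThen`. The fault rule demands an unchanged
state, which `Step.state_eq_of_fault` supplies. -/
theorem step_seq_iff {c₁ c₂ : Prog V} {σ : State V} {a : ℕ} {k : Branch} {p : ℚ} {t' : Conf V} :
    Step (.run (.seq c₁ c₂), σ) a k p t' ↔
      ∃ t'', Step (.run c₁, σ) a k p t'' ∧ andThen c₂ t'' = t' := by
  constructor
  · intro hs
    cases hs with
    | seq_fault _ _ _ _ _ _ _ hs => exact ⟨_, hs, rfl⟩
    | seq_term _ _ _ _ _ _ _ _ _ hs => exact ⟨_, hs, rfl⟩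
    | seq_run _ _ _ _ _ _ _ _ _ _ hs => exact ⟨_, hs, rfl⟩
  · rintro ⟨⟨_ | _ | _, σ'⟩, hs, rfl⟩
    · exact Step.seq_run _ _ _ _ _ _ _ _ _ _ hs
    · exact Step.seq_term _ _ _ _ _ _ _ _ _ hs
    · obtain rfl : σ' = σ := hs.state_eq_of_fault rfl
      exact Step.seq_fault _ _ _ _ _ _ _ hs

theorem steps_seq (c₁ c₂ : Prog V) (σ : State V) (a : ℕ) :
    steps (.run (.seq c₁ c₂), σ) a =
      Prod.map id (Prod.map id (andThen c₂)) '' steps (.run c₁, σ) a := by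
  ext ⟨k, p, t'⟩
  constructor
  · intro hs
    obtain ⟨t'', hs', rfl⟩ := step_seq_iff.mp hs
    exact ⟨(k, p, t''), hs', rfl⟩
  · rintro ⟨⟨k', p', t''⟩, hs', heq⟩
    cases heq
    exact step_seq_iff.mpr ⟨t'', hs', rfl⟩

theorem enabled_seq (c₁ c₂ : Prog V) (σ : State V) :
    enabled (.run (.seq c₁ c₂), σ) = enabled (.run c₁, σ) := by
  ext a
  constructor
  · rintro ⟨k, p, t', hp, hs⟩
    obtain ⟨t'', hs', -⟩ := step_seq_iff.mp hs
    exact ⟨k, p, t'', hp, hs'⟩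
  · rintro ⟨k, p, t', hp, hs⟩
    exact ⟨k, p, _, hp, step_seq_iff.mpr ⟨t', hs, rfl⟩⟩

theorem expect_seq (c₁ c₂ : Prog V) (σ : State V) (a : ℕ) (F : Conf V → ℝ≥0∞) :
    expect (.run (.seq c₁ c₂), σ) a F = expect (.run c₁, σ) a (F ∘ andThen c₂) := by
  rw [expect_eq_tsum_steps, steps_seq, expect_eq_tsum_steps]
  exact tsum_image (fun x : Branch × ℚ × Conf V => weight x.2.1 * F x.2.2)
    (Function.injective_id.prodMap
      (Function.injective_id.prodMap (andThen_injective c₂))).injOn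

theorem minExpect_seq (c₁ c₂ : Prog V) (σ : State V) (F : Conf V → ℝ≥0∞) :
    minExpect (.run (.seq c₁ c₂), σ) F = minExpect (.run c₁, σ) (F ∘ andThen c₂) := by
  simp only [minExpect, enabled_seq, expect_seq]

/-- Running programs never block, so schedulers are constrained there; and total probability at most
one lets a constant error pass through an expectation without growing. -/
theorem enabled_nonempty_and_expect_one (c : Prog V) (σ : State V) :
    (enabled (.run c, σ)).Nonempty ∧
      ∀ a ∈ enabled (.run c, σ), expect (.run c, σ) a (fun _ => 1) ≤ 1 := by
  have of_stepsTo : ∀ {t t' : Conf V}, StepsTo t t' →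
      (enabled t).Nonempty ∧ ∀ a ∈ enabled t, expect t a (fun _ => 1) ≤ 1 := by
    intro t t' ht
    rw [ht.enabled_eq]
    refine ⟨Set.singleton_nonempty 0, ?_⟩
    rintro a rfl
    rw [ht.expect_zero]
  obtain ⟨s, h⟩ := σ
  induction c with
  | skip => exact of_stepsTo (stepsTo_skip _)
  | assign x e => exact of_stepsTo (stepsTo_assign x e s h)
  | seq c₁ c₂ ih₁ _ =>
    rw [enabled_seq]
    refine ⟨ih₁.1, fun a ha => ?_⟩
    rw [expect_seq]
    exact ih₁.2 a ha
  | cond b c₁ c₂ => exact of_stepsTo (stepsTo_cond b c₁ c₂ s h)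
  | loop b c => exact of_stepsTo (stepsTo_loop b c s h)
  | choice c₁ p c₂ =>
    rw [enabled_choice]
    refine ⟨Set.singleton_nonempty 0, ?_⟩
    rintro a rfl
    rw [expect_choice, mul_one, mul_one, weight_add_weight_one_sub]
  | alloc x es hes =>
    rw [enabled_alloc]
    refine ⟨(Heap.avail_nonempty _ _).image _, ?_⟩
    rintro a ⟨u, hu, rfl⟩
    exact (expect_alloc hu _).le
  | mutate e e' =>
    rcases mem_dom_or_fault e s h with ⟨u, hu, he⟩ | hf
    · exact of_stepsTo (stepsTo_mutate he hu)
    · exact of_stepsTo (stepsTo_mutate_fault hf)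
  | lookup x e =>
    rcases mem_dom_or_fault e s h with ⟨u, hu, he⟩ | hf
    · obtain ⟨v, hv⟩ := Option.ne_none_iff_exists'.mp hu
      exact of_stepsTo (stepsTo_lookup he hv)
    · exact of_stepsTo (stepsTo_lookup_fault hf)
  | free e =>
    rcases mem_dom_or_fault e s h with ⟨u, hu, he⟩ | hf
    · exact of_stepsTo (stepsTo_free he hu)
    · exact of_stepsTo (stepsTo_free_fault hf)

/-! ### Expected rewards -/

theorem tsum_list {α : Type*} (g : List α → ℝ≥0∞) :
    ∑' l, g l = g [] + ∑' (a : α) (l : List α), g (a :: l) := by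
  let f : Unit ⊕ (α × List α) → List α := Sum.elim (fun _ => []) fun x => x.1 :: x.2
  have hf : Function.Bijective f := by
    constructor
    · rintro (⟨⟩ | ⟨a, l⟩) (⟨⟩ | ⟨b, m⟩) h <;> simp_all [f]
    · rintro (_ | ⟨a, l⟩)
      · exact ⟨Sum.inl (), rfl⟩
      · exact ⟨Sum.inr (a, l), rfl⟩
  rw [← (Equiv.ofBijective f hf).tsum_eq g,
    ENNReal.summable.tsum_sum ENNReal.summable, tsum_fintype,
    ← ENNReal.tsum_prod (f := fun a l => g (a :: l))]
  simp [f]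

/-- The contribution of the path `t :: rest` with the history `past` to the expected reward. -/
noncomputable def pathReward (X : Expectation V) (ρ : Scheduler V) (past : List (Conf V))
    (t : Conf V) (rest : List (Conf V)) : ℝ≥0∞ :=
  pathProb ρ past t rest * reward X ((t :: rest).getLast (List.cons_ne_nil _ _))

theorem pathReward_nil (X : Expectation V) (ρ : Scheduler V) (past : List (Conf V)) (t : Conf V) :
    pathReward X ρ past t [] = reward X t := by
  simp [pathReward, pathProb]

theorem pathReward_cons (X : Expectation V) (ρ : Scheduler V) (past : List (Conf V))
    (t t' : Conf V) (rest : List (Conf V)) :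
    pathReward X ρ past t (t' :: rest) =
      prob t (ρ.act past t) t' * pathReward X ρ (past ++ [t]) t' rest := by
  simp [pathReward, pathProb, mul_assoc]

/-- Such a sequence either has a step of probability zero or ends without reward, so path sums may
range over all lists. -/
theorem pathReward_eq_zero (X : Expectation V) (ρ : Scheduler V) {past : List (Conf V)}
    {t : Conf V} {rest : List (Conf V)} (h : ¬ IsGoalPath ρ past t rest) :
    pathReward X ρ past t rest = 0 := by
  induction rest generalizing past t with
  | nil =>
    rw [pathReward_nil]
    obtain ⟨_ | _ | _, σ⟩ := t
    · rfl
    · exact absurd rfl h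
    · rfl
  | cons t' rest ih =>
    rw [pathReward_cons]
    by_cases h0 : prob t (ρ.act past t) t' = 0
    · rw [h0, zero_mul]
    · rw [ih fun hc => h ⟨pos_iff_ne_zero.mpr h0, hc⟩, mul_zero]

/-- The expected reward from `t` on after the history `past`. -/
noncomputable def historyReward (X : Expectation V) (ρ : Scheduler V) (past : List (Conf V))
    (t : Conf V) : ℝ≥0∞ :=
  ∑' rest, pathReward X ρ past t rest

theorem expRewardOf_eq_historyReward (X : Expectation V) (ρ : Scheduler V) (t : Conf V) :
    expRewardOf X ρ t = historyReward X ρ [] t := by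
  refine (tsum_subtype {rest | IsGoalPath ρ [] t rest} (pathReward X ρ [] t)).trans ?_
  refine tsum_congr fun rest => ?_
  by_cases h : IsGoalPath ρ [] t rest
  · exact Set.indicator_of_mem (s := {rest | IsGoalPath ρ [] t rest}) h _
  · rw [pathReward_eq_zero X ρ h]
    exact Set.indicator_of_notMem (s := {rest | IsGoalPath ρ [] t rest}) h _

/-- First-step decomposition: a path either stops at once or continues with a next configuration. -/
theorem historyReward_eq (X : Expectation V) (ρ : Scheduler V) (past : List (Conf V))
    (t : Conf V) :
    historyReward X ρ past t =
      reward X t + expect t (ρ.act past t) (historyReward X ρ (past ++ [t])) := by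
  rw [historyReward, tsum_list, pathReward_nil, expect]
  simp only [pathReward_cons, ENNReal.tsum_mul_left, historyReward]

/-- The expected reward from `t` on after the history `past`, on paths of fewer than `n` steps. -/
noncomputable def boundedReward (X : Expectation V) (ρ : Scheduler V) :
    ℕ → List (Conf V) → Conf V → ℝ≥0∞
  | 0, _, _ => 0
  | n + 1, past, t =>
    reward X t + expect t (ρ.act past t) (boundedReward X ρ n (past ++ [t]))

theorem tsum_length_lt (X : Expectation V) (ρ : Scheduler V) (n : ℕ) (past : List (Conf V))
    (t : Conf V) :
    ∑' rest, (if rest.length < n then pathReward X ρ past t rest else 0) =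
      boundedReward X ρ n past t := by
  induction n generalizing past t with
  | zero => simp [boundedReward]
  | succ n ih =>
    rw [tsum_list, boundedReward, expect]
    simp only [List.length_nil, Nat.zero_lt_succ, if_true, pathReward_nil, List.length_cons,
      Nat.add_lt_add_iff_right, pathReward_cons, ← ih, ← ENNReal.tsum_mul_left, mul_ite, mul_zero]

theorem historyReward_le_of_boundedReward_le {X : Expectation V} {ρ : Scheduler V}
    {past : List (Conf V)} {t : Conf V} {r : ℝ≥0∞} (h : ∀ n, boundedReward X ρ n past t ≤ r) :
    historyReward X ρ past t ≤ r := by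
  rw [historyReward, ENNReal.tsum_eq_iSup_sum]
  refine iSup_le fun S => ?_
  -- A finite partial sum involves paths of bounded length; the `+ 1` accounts for the strict bound
  -- on lengths.
  refine le_trans ?_ (h (S.sup List.length + 1))
  rw [← tsum_length_lt]
  refine le_trans (Finset.sum_le_sum fun rest hrest => ?_) (ENNReal.sum_le_tsum S)
  rw [if_pos (Nat.lt_succ_of_le (Finset.le_sup (f := List.length) hrest))]

/-- The scheduler that behaves like `ρ` does after the history `past`. -/
def Scheduler.shift (ρ : Scheduler V) (past : List (Conf V)) : Scheduler V where
  act past' t := ρ.act (past ++ past') t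
  act_mem past' t := ρ.act_mem (past ++ past') t

theorem pathReward_shift (X : Expectation V) (ρ : Scheduler V) (past past' : List (Conf V))
    (t : Conf V) (rest : List (Conf V)) :
    pathReward X (ρ.shift past) past' t rest = pathReward X ρ (past ++ past') t rest := by
  induction rest generalizing past' t with
  | nil => rw [pathReward_nil, pathReward_nil]
  | cons t' rest ih =>
    rw [pathReward_cons, pathReward_cons, ih, List.append_assoc]
    rfl

/-- Knowing a history cannot beat the infimum: the shifted scheduler obtains the same reward from an
empty history. -/
theorem expReward_le_historyReward (X : Expectation V) (ρ : Scheduler V) (past : List (Conf V))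
    (t : Conf V) : expReward X t ≤ historyReward X ρ past t := by
  refine iInf_le_of_le (ρ.shift past) ?_
  rw [expRewardOf_eq_historyReward, historyReward, historyReward]
  simp [pathReward_shift]

/-! ### Minimal expected rewards as a least solution of the optimality equations -/

/-- The values `F` are an upper bound on their one-step optimal values. -/
structure IsSuperSolution (X : Expectation V) (F : Conf V → ℝ≥0∞) : Prop where
  term (σ : State V) : X σ ≤ F (.term, σ)
  run (c : Prog V) (σ : State V) : minExpect (.run c, σ) F ≤ F (.run c, σ)

theorem isSuperSolution_expReward (X : Expectation V) : IsSuperSolution X (expReward X) where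
  term σ := by
    refine le_iInf fun ρ => ?_
    rw [expRewardOf_eq_historyReward, historyReward_eq]
    exact le_self_add
  run c σ := by
    refine le_iInf fun ρ => ?_
    rw [expRewardOf_eq_historyReward, historyReward_eq]
    refine le_trans ?_ le_add_self
    refine (iInf₂_le _ (ρ.act_mem [] _ (enabled_nonempty_and_expect_one c σ).1)).trans ?_
    exact expect_mono _ _ fun t' => expReward_le_historyReward X ρ _ t'

/-! ### Nearly optimal schedulers. -/

theorem not_step_term {σ : State V} {a : ℕ} {k : Branch} {p : ℚ} {t' : Conf V} :
    ¬ Step (.term, σ) a k p t' := nofun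

theorem not_step_fault {σ : State V} {a : ℕ} {k : Branch} {p : ℚ} {t' : Conf V} :
    ¬ Step (.fault, σ) a k p t' := nofun

theorem expect_term (σ : State V) (a : ℕ) (F : Conf V → ℝ≥0∞) :
    expect (.term, σ) a F = 0 := by
  simp [expect, prob, not_step_term]

theorem expect_fault (σ : State V) (a : ℕ) (F : Conf V → ℝ≥0∞) :
    expect (.fault, σ) a F = 0 := by
  simp [expect, prob, not_step_fault]

theorem exists_nearly_optimal_action (F : Conf V → ℝ≥0∞) (t : Conf V) {δ : ℝ≥0∞} (hδ : δ ≠ 0) :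
    ∃ a, (enabled t).Nonempty → a ∈ enabled t ∧ expect t a F ≤ minExpect t F + δ := by
  by_cases hne : (enabled t).Nonempty
  · by_cases htop : minExpect t F = ∞
    · obtain ⟨a, ha⟩ := hne
      exact ⟨a, fun _ => ⟨ha, by simp [htop]⟩⟩
    · have hlt : minExpect t F < minExpect t F + δ := ENNReal.lt_add_right htop hδ
      conv_lhs at hlt => rw [minExpect]
      simp only [iInf_lt_iff] at hlt
      obtain ⟨a, ha, hlt⟩ := hlt
      exact ⟨a, fun _ => ⟨ha, hlt.le⟩⟩
  · exact ⟨0, fun h => absurd h hne⟩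

/-- A scheduler whose choices have an error of at most `δ n` after a history of length `n`. -/
theorem exists_nearly_optimal_scheduler (F : Conf V → ℝ≥0∞) {δ : ℕ → ℝ≥0∞} (hδ : ∀ n, δ n ≠ 0) :
    ∃ ρ : Scheduler V, ∀ past t, (enabled t).Nonempty →
      expect t (ρ.act past t) F ≤ minExpect t F + δ past.length := by
  choose act hact using fun (past : List (Conf V)) (t : Conf V) =>
    exists_nearly_optimal_action F t (hδ past.length)
  exact ⟨⟨act, fun past t h => (hact past t h).1⟩, fun past t h => (hact past t h).2⟩

/-- The error budget `δ n` after a history of length `n` is split in halves `δ (n + 1)`: one pays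
for the current choice of action, the other for all later ones. -/
theorem boundedReward_le {X : Expectation V} {F : Conf V → ℝ≥0∞} {ρ : Scheduler V}
    {δ : ℕ → ℝ≥0∞} (hF : IsSuperSolution X F)
    (hρ : ∀ past t, (enabled t).Nonempty →
      expect t (ρ.act past t) F ≤ minExpect t F + δ (past.length + 1))
    (hδ : ∀ n, δ (n + 1) + δ (n + 1) = δ n) (n : ℕ) (past : List (Conf V)) (t : Conf V) :
    boundedReward X ρ n past t ≤ F t + δ past.length := by
  induction n generalizing past t with
  | zero => exact zero_le
  | succ n ih =>
    rw [boundedReward]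
    obtain ⟨c | _ | _, σ⟩ := t
    · obtain ⟨hne, hone⟩ := enabled_nonempty_and_expect_one c σ
      set a := ρ.act past (.run c, σ) with ha
      calc 0 + expect (.run c, σ) a (boundedReward X ρ n (past ++ [(.run c, σ)]))
          ≤ expect (.run c, σ) a (fun t' => F t' + δ (past.length + 1)) := by
            rw [zero_add]
            refine expect_mono _ _ fun t' => (ih _ t').trans ?_
            simp
        _ ≤ expect (.run c, σ) a F + δ (past.length + 1) := by
            rw [expect_add, expect_const]
            gcongr
            exact mul_le_of_le_one_left zero_le (hone a (ρ.act_mem past _ hne))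
        _ ≤ F (.run c, σ) + δ (past.length + 1) + δ (past.length + 1) := by
            gcongr
            exact (hρ past _ hne).trans (by gcongr; exact hF.run c σ)
        _ = F (.run c, σ) + δ past.length := by rw [add_assoc, hδ]
    · rw [expect_term, add_zero]
      exact (hF.term σ).trans le_self_add
    · rw [expect_fault]
      exact (zero_add (0 : ℝ≥0∞)).trans_le zero_le

theorem IsSuperSolution.expReward_le {X : Expectation V} {F : Conf V → ℝ≥0∞}
    (hF : IsSuperSolution X F) (t : Conf V) : expReward X t ≤ F t := by
  refine ENNReal.le_of_forall_pos_le_add fun ε hε _ => ?_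
  let δ : ℕ → ℝ≥0∞ := fun n => ε * 2⁻¹ ^ n
  have hδ0 : ∀ n, δ n ≠ 0 := fun n => by simp [δ, hε.ne']
  have hδ : ∀ n, δ (n + 1) + δ (n + 1) = δ n := fun n => by
    simp only [δ, pow_succ]
    rw [← mul_add, ← mul_add, ENNReal.inv_two_add_inv_two, mul_one]
  -- The index shift leaves the first choice an error of `ε / 2`, so the whole budget is `δ 0 = ε`.
  obtain ⟨ρ, hρ⟩ := exists_nearly_optimal_scheduler F fun n => hδ0 (n + 1)
  refine iInf_le_of_le ρ ?_
  rw [expRewardOf_eq_historyReward]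
  refine historyReward_le_of_boundedReward_le fun n => ?_
  simpa [δ] using boundedReward_le hF hρ hδ n [] t

/-! ### Weakest preexpectations and one-step expectations -/

/-- The values of configurations according to the weakest preexpectation semantics. -/
noncomputable def wpValue (X : Expectation V) : Conf V → ℝ≥0∞
  | (.run c, σ) => wp c X σ
  | (.term, σ) => X σ
  | (.fault, _) => 0

theorem wpValue_comp_andThen (X : Expectation V) (c : Prog V) :
    wpValue X ∘ andThen c = wpValue (wp c X) := by
  funext ⟨k, σ⟩
  cases k <;> rfl

theorem wp_cond_apply (b : Guard V) (c₁ c₂ : Prog V) (X : Expectation V) (σ : State V) :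
    wp (.cond b c₁ c₂) X σ = if b σ.1 = true then wp c₁ X σ else wp c₂ X σ := by
  change iverson (fun σ => b σ.1 = true) σ * wp c₁ X σ
    + iverson (fun σ => ¬ b σ.1 = true) σ * wp c₂ X σ = _
  by_cases h : b σ.1 = true <;> simp [iverson, h]

theorem wp_loop_apply (b : Guard V) (c : Prog V) (X : Expectation V) (σ : State V) :
    wp (.loop b c) X σ = if b σ.1 = true then wp c (wp (.loop b c) X) σ else X σ := by
  rw [← charFun_apply b (wp c) X]
  exact (congrFun (charFun b (wp c) X).map_lfp σ).symm

theorem wp_alloc_apply (x : V) (es : List (AExpr V)) (hes : es ≠ []) (X : Expectation V)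
    (σ : State V) :
    wp (.alloc x es hes) X σ = ⨅ u ∈ σ.2.avail es.length, wpValue X (allocConf x es σ u) := by
  refine iInf_congr fun u => iInf_congr fun hu => ?_
  exact sepImp_pointsTo (s := σ.1) (h := σ.2) _ rfl (Heap.disj_block (by simpa using hu))

theorem wp_mutate_apply {e e' : AExpr V} {s : Stack V} {h : Heap} {u : ℕ+} (X : Expectation V)
    (he : e s = ((u : ℕ) : ℤ)) (hu : u ∈ h.dom) :
    wp (.mutate e e') X (s, h) = X (s, h.update u (e' s)) :=
  (sepCon_allocated _ he hu).trans (sepImp_erase X he)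

theorem wp_lookup_apply {x : V} {e : AExpr V} {s : Stack V} {h : Heap} {u : ℕ+} {v : ℤ}
    (X : Expectation V) (he : e s = ((u : ℕ) : ℤ)) (hv : h.cells u = some v) :
    wp (.lookup x e) X (s, h) = X (Function.update s x v, h) := by
  change (⨆ w : ℤ, sepCon (iverson (pointsTo e [fun _ => w]))
    (sepImp (pointsTo e [fun _ => w]) (subst X x fun _ => w))) (s, h) = _
  rw [iSup_apply]
  have hval : sepCon (iverson (pointsTo e [fun _ => v]))
      (sepImp (pointsTo e [fun _ => v]) (subst X x fun _ => v)) (s, h) =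
        X (Function.update s x v, h) := by
    rw [sepCon_pointsTo _ he hv, sepImp_erase _ he, Heap.update_eq_self hv]
    rfl
  refine le_antisymm (iSup_le fun w => ?_) (le_iSup_of_le v hval.ge)
  by_cases hw : w = v
  · rw [hw, hval]
  · rw [sepCon_pointsTo_eq_zero]
    · exact zero_le
    · intro u' hu' hc
      rw [address_unique hu' he, hv] at hc
      exact hw (Option.some.inj hc).symm

theorem wp_lookup_fault {x : V} {e : AExpr V} {s : Stack V} {h : Heap} (X : Expectation V)
    (hf : ∀ u ∈ h.dom, e s ≠ ((u : ℕ) : ℤ)) : wp (.lookup x e) X (s, h) = 0 := by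
  change (⨆ w : ℤ, sepCon (iverson (pointsTo e [fun _ => w]))
    (sepImp (pointsTo e [fun _ => w]) (subst X x fun _ => w))) (s, h) = _
  rw [iSup_apply]
  refine le_antisymm (iSup_le fun w => (sepCon_pointsTo_eq_zero _ ?_).le) zero_le
  exact fun u hu hc => hf u (by simp [Heap.mem_dom, hc]) hu

/-- Only sequencing needs the induction, applied to `c₁` with postexpectation `wp c₂ X`; a loop just
needs the fixed point equation. -/
theorem wp_apply_eq_minExpect (c : Prog V) (X : Expectation V) (σ : State V) :
    wp c X σ = minExpect (.run c, σ) (wpValue X) := by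
  obtain ⟨s, h⟩ := σ
  induction c generalizing X with
  | skip =>
    rw [(stepsTo_skip _).minExpect_eq]
    rfl
  | assign x e =>
    rw [(stepsTo_assign _ _ _ _).minExpect_eq]
    rfl
  | seq c₁ c₂ ih₁ _ =>
    rw [minExpect_seq, wpValue_comp_andThen, ← ih₁]
    rfl
  | cond b c₁ c₂ =>
    rw [(stepsTo_cond _ _ _ _ _).minExpect_eq, wp_cond_apply]
    split_ifs <;> rfl
  | loop b c =>
    rw [(stepsTo_loop _ _ _ _).minExpect_eq, wp_loop_apply]
    split_ifs <;> rfl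
  | choice c₁ p c₂ =>
    rw [minExpect_choice]
    rfl
  | alloc x es hes => rw [minExpect_alloc, wp_alloc_apply]
  | mutate e e' =>
    rcases mem_dom_or_fault e s h with ⟨u, hu, he⟩ | hf
    · rw [(stepsTo_mutate he hu).minExpect_eq, wp_mutate_apply X he hu]
      rfl
    · rw [(stepsTo_mutate_fault hf).minExpect_eq]
      exact sepCon_allocated_fault _ hf
  | lookup x e =>
    rcases mem_dom_or_fault e s h with ⟨u, hu, he⟩ | hf
    · obtain ⟨v, hv⟩ := Option.ne_none_iff_exists'.mp hu
      rw [(stepsTo_lookup he hv).minExpect_eq, wp_lookup_apply X he hv]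
      rfl
    · rw [(stepsTo_lookup_fault hf).minExpect_eq]
      exact wp_lookup_fault X hf
  | free e =>
    rcases mem_dom_or_fault e s h with ⟨u, hu, he⟩ | hf
    · rw [(stepsTo_free he hu).minExpect_eq]
      exact sepCon_allocated _ he hu
    · rw [(stepsTo_free_fault hf).minExpect_eq]
      exact sepCon_allocated_fault _ hf

/-! ### Weakest preexpectations as the least super-solution. -/

theorem isSuperSolution_wpValue (X : Expectation V) : IsSuperSolution X (wpValue X) where
  term _ := le_rfl
  run c σ := (wp_apply_eq_minExpect c X σ).ge

/-- Termination of the first component means that `c` starts, so the value of `c` under `F` becomes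
the new postexpectation. -/
theorem IsSuperSolution.comp_andThen {X : Expectation V} {F : Conf V → ℝ≥0∞}
    (hF : IsSuperSolution X F) (c : Prog V) :
    IsSuperSolution (fun σ => F (.run c, σ)) (F ∘ andThen c) where
  term _ := le_rfl
  run c' σ := by
    rw [← minExpect_seq]
    exact hF.run _ _

theorem IsSuperSolution.wp_le {X : Expectation V} {F : Conf V → ℝ≥0∞}
    (hF : IsSuperSolution X F) (c : Prog V) (σ : State V) : wp c X σ ≤ F (.run c, σ) := by
  have of_wpValue_le : ∀ {X : Expectation V} {F : Conf V → ℝ≥0∞} {c : Prog V} {σ : State V}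
      {t : Conf V}, IsSuperSolution X F → StepsTo (.run c, σ) t → wpValue X t ≤ F t →
      wp c X σ ≤ F (.run c, σ) := by
    intro X F c σ t hF ht hle
    refine le_trans ?_ (hF.run c σ)
    rwa [wp_apply_eq_minExpect, ht.minExpect_eq, ht.minExpect_eq]
  induction c generalizing X F σ with
  | skip => exact of_wpValue_le hF (stepsTo_skip _) (hF.term _)
  | assign x e => exact of_wpValue_le hF (stepsTo_assign _ _ _ _) (hF.term _)
  | seq c₁ c₂ ih₁ ih₂ =>
    calc wp c₁ (wp c₂ X) σ ≤ wp c₁ (fun σ => F (.run c₂, σ)) σ :=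
          (wp c₁).monotone (fun σ => ih₂ hF σ) σ
      _ ≤ F (.run (.seq c₁ c₂), σ) := ih₁ (hF.comp_andThen c₂) σ
  | cond b c₁ c₂ ih₁ ih₂ =>
    refine of_wpValue_le hF (stepsTo_cond b c₁ c₂ σ.1 σ.2) ?_
    split_ifs
    · exact ih₁ hF _
    · exact ih₂ hF _
  | loop b c ih =>
    -- Park induction: it suffices that the values of the loop under `F` form a prefixed point.
    refine OrderHom.lfp_le (charFun b (wp c) X) (a := fun σ => F (.run (.loop b c), σ)) ?_ σ
    intro σ
    have hstep := hF.run (.loop b c) σ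
    rw [(stepsTo_loop b c σ.1 σ.2).minExpect_eq] at hstep
    refine le_trans ?_ hstep
    rw [charFun_apply]
    split_ifs
    -- The unfolded loop is the body followed by the loop, so the induction hypothesis is used with
    -- the loop's values under `F` as postexpectation.
    · exact ih (hF.comp_andThen (.loop b c)) σ
    · exact hF.term σ
  | choice c₁ p c₂ ih₁ ih₂ =>
    refine le_trans ?_ (hF.run _ _)
    rw [minExpect_choice]
    exact add_le_add (mul_le_mul_right (ih₁ hF σ) _) (mul_le_mul_right (ih₂ hF σ) _)
  | alloc x es hes =>
    refine le_trans ?_ (hF.run _ _)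
    rw [minExpect_alloc, wp_alloc_apply]
    exact iInf₂_mono fun u _ => hF.term _
  | mutate e e' =>
    rcases mem_dom_or_fault e σ.1 σ.2 with ⟨u, hu, he⟩ | hf
    · exact of_wpValue_le hF (stepsTo_mutate he hu) (hF.term _)
    · exact of_wpValue_le hF (stepsTo_mutate_fault hf) zero_le
  | lookup x e =>
    rcases mem_dom_or_fault e σ.1 σ.2 with ⟨u, hu, he⟩ | hf
    · obtain ⟨v, hv⟩ := Option.ne_none_iff_exists'.mp hu
      exact of_wpValue_le hF (stepsTo_lookup he hv) (hF.term _)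
    · exact of_wpValue_le hF (stepsTo_lookup_fault hf) zero_le
  | free e =>
    rcases mem_dom_or_fault e σ.1 σ.2 with ⟨u, hu, he⟩ | hf
    · exact of_wpValue_le hF (stepsTo_free he hu) (hF.term _)
    · exact of_wpValue_le hF (stepsTo_free_fault hf) zero_le

end HPGCL

/-- Soundness of weakest preexpectations with respect to the operational semantics. -/
theorem mainTheorem1 {V : Type*} [DecidableEq V] (c : HPGCL.Prog V) (X : HPGCL.Expectation V)
    (s : HPGCL.Stack V) (h : HPGCL.Heap) :
    HPGCL.wp c X (s, h) = HPGCL.expReward X (HPGCL.Control.run c, (s, h)) :=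
  le_antisymm ((HPGCL.isSuperSolution_expReward X).wp_le c (s, h))
    ((HPGCL.isSuperSolution_wpValue X).expReward_le (HPGCL.Control.run c, (s, h)))
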